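/- Let $G=(V,E)$ be a finite simple graph. A set $S\subseteq V$ is called odd independent if it is independent and every vertex $v\in V\setminus S$ has either no neighbour in $S$ or an odd number of neighbours in $S$. Let $\alpha_{\mathrm{od}}(G)$ denote the largest cardinality of an odd independent set of $G$. Let $Q_d$ denote the $d$-dimensional hypercube, with vertex set $\{0,1\}^d$, where two vertices are adjacent if and only if they differ in exactly one coordinate. Then: (i) $\alpha_{\mathrm{od}}(Q_{4k}) \ge 2\sum_{i=1}^{k}\binom{4k-1}{2i-1}$ for every integer $k\ge 1$; (ii) $\alpha_{\mathrm{od}}(Q_4)=6$, $\alpha_{\mathrm{od}}(Q_6)=24$ and $\alpha_{\mathrm{od}}(Q_8)=112$; (iii) $\alpha_{\mathrm{od}}(Q_d)\ge \frac{7}{16}\cdot 2^d$ for every even integer $d\ge 8$. -/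

import Mathlib

/-- `S` is an odd independent set of `G`: it is independent, and every vertex outside `S` has
either no neighbour in `S` or an odd number of neighbours in `S`. -/
def IsOddIndepSet {V : Type*} (G : SimpleGraph V) (S : Finset V) : Prop :=
  G.IsIndepSet (S : Set V) ∧
    ∀ v : V, v ∉ S →
      G.neighborSet v ∩ (S : Set V) = ∅ ∨ Odd (G.neighborSet v ∩ (S : Set V)).ncard

/-- The odd independence number of a finite graph: the largest cardinality of an odd
independent set. -/
noncomputable def oddIndepNum {V : Type*} [Fintype V] (G : SimpleGraph V) : ℕ :=
  sSup {n : ℕ | ∃ S : Finset V, IsOddIndepSet G S ∧ S.card = n}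

/-- The `d`-dimensional hypercube: the vertices are the 0-1 sequences of length `d`, and two of
them are adjacent iff they differ in exactly one coordinate. -/
def hypercube (d : ℕ) : SimpleGraph (Fin d → Bool) where
  Adj x y := hammingDist x y = 1
  symm := ⟨fun x y h => by rw [hammingDist_comm]; exact h⟩
  loopless := ⟨fun x h => by simp at h⟩

/-- The supremum in `oddIndepNum` is a maximum. -/
theorem oddIndepNum_isGreatest {V : Type*} [Fintype V] (G : SimpleGraph V) :
    IsGreatest {n : ℕ | ∃ S : Finset V, IsOddIndepSet G S ∧ S.card = n} (oddIndepNum G) := by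
  have hb : BddAbove {n : ℕ | ∃ S : Finset V, IsOddIndepSet G S ∧ S.card = n} :=
    ⟨Fintype.card V, by rintro n ⟨S, -, rfl⟩; exact S.card_le_univ⟩
  refine ⟨Nat.sSup_mem ⟨0, ∅, ⟨?_, ?_⟩, rfl⟩ hb, fun n hn => le_csSup hb hn⟩
  · simp [SimpleGraph.IsIndepSet]
  · intro v _
    left
    simp

/-! Upper bounds. For an odd independent set S, let T be the vertices with a neighbour in S and U
the remaining vertices outside S. Each v in T has an odd number of neighbours in S and, by counting
walks of length two modulo 2, an even number in T. If d is even, v therefore has a neighbour in U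
and at most d - 1 in S. Double counting gives |T| ≤ d|U| and d|S| ≤ (d - 1)|T|, hence |S| ≤ (d -
1)2^d / (2d): this is 6 for d = 4 and 112 for d = 8, both attained.

For d = 6 the bound is only 26. The congruence |T| ≡ 2|S| mod 4 (`card_touched_modEq`) shows that a
set with more than 24 elements has at most two vertices in T whose degree into S is not 5. Some x in
S is adjacent to neither of them, and the structure around such an x forces three of them
(`three_le_card_deficient`), a contradiction.

Lower bounds. `halfLayers` gives (i), and 6 for d = 4. The even words outside the extended Hamming
code give 112 for d = 8. Replacing one coordinate by the parity of three preserves density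
(`four_mul_oddIndepNum_hypercube_le`); this carries 6 to 24 and spreads 7/16 to all even d ≥ 8. -/

/-- The vertex of the hypercube obtained from `v` by flipping coordinate `i`. -/
def flipAt {d : ℕ} (v : Fin d → Bool) (i : Fin d) : Fin d → Bool :=
  fun j => xor (v j) (decide (j = i))

/-! ### Coordinate flips and neighbour counts -/

section Flip

variable {d : ℕ}

theorem flipAt_apply (v : Fin d → Bool) (i j : Fin d) :
    flipAt v i j = xor (v j) (decide (j = i)) := rfl

theorem flipAt_flipAt (v : Fin d → Bool) (i : Fin d) : flipAt (flipAt v i) i = v := by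
  funext j; simp [flipAt]

theorem flipAt_comm (v : Fin d → Bool) (i j : Fin d) :
    flipAt (flipAt v i) j = flipAt (flipAt v j) i := by
  funext k; simp only [flipAt, Bool.xor_right_comm]

theorem flipAt_injective (i : Fin d) : Function.Injective fun v : Fin d → Bool => flipAt v i :=
  Function.LeftInverse.injective (g := fun v => flipAt v i) fun v => flipAt_flipAt v i

theorem flipAt_index_injective (v : Fin d → Bool) : Function.Injective (flipAt v) := by
  intro i j h
  have := congrFun h i
  by_contra hij
  simp [flipAt, hij] at this

/-- Flipping coordinate `i` as a permutation of the vertices. -/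
def flipEquiv (i : Fin d) : (Fin d → Bool) ≃ (Fin d → Bool) where
  toFun v := flipAt v i
  invFun v := flipAt v i
  left_inv v := flipAt_flipAt v i
  right_inv v := flipAt_flipAt v i

theorem hypercube_adj_iff {v w : Fin d → Bool} :
    (hypercube d).Adj v w ↔ ∃ i, w = flipAt v i := by
  change hammingDist v w = 1 ↔ _
  unfold hammingDist
  rw [Finset.card_eq_one]
  refine exists_congr fun i => ⟨fun h => ?_, fun h => ?_⟩
  · funext j
    have hj : v j ≠ w j ↔ j = i := by
      simpa using Finset.ext_iff.1 h j
    by_cases hji : j = i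
    · have := hj.2 hji
      rw [flipAt_apply, decide_eq_true hji, Bool.xor_true]
      revert this
      cases v j <;> cases w j <;> simp
    · have : v j = w j := by
        by_contra hne
        exact hji (hj.1 hne)
      simp [flipAt, hji, this]
  · subst h
    ext j
    rw [Finset.mem_filter, Finset.mem_singleton, flipAt_apply]
    by_cases hji : j = i <;> simp [hji]

/-- The number of neighbours of `v` in `S`. -/
def degIn (S : Finset (Fin d → Bool)) (v : Fin d → Bool) : ℕ :=
  (Finset.univ.filter fun i => flipAt v i ∈ S).card

theorem degIn_eq_sum (S : Finset (Fin d → Bool)) (v : Fin d → Bool) :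
    degIn S v = ∑ i, if flipAt v i ∈ S then 1 else 0 :=
  Finset.card_filter _ _

theorem degIn_le (S : Finset (Fin d → Bool)) (v : Fin d → Bool) : degIn S v ≤ d :=
  (Finset.card_filter_le _ _).trans_eq (by simp)

theorem degIn_pos_iff {S : Finset (Fin d → Bool)} {v : Fin d → Bool} :
    0 < degIn S v ↔ ∃ i, flipAt v i ∈ S := by
  simp [degIn, Finset.card_pos, Finset.Nonempty]

theorem neighborSet_inter_eq (S : Finset (Fin d → Bool)) (v : Fin d → Bool) :
    (hypercube d).neighborSet v ∩ (S : Set (Fin d → Bool)) =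
      ((Finset.univ.filter fun i => flipAt v i ∈ S).image (flipAt v) : Finset _) := by
  ext w
  simp only [Set.mem_inter_iff, SimpleGraph.mem_neighborSet, hypercube_adj_iff, Finset.mem_coe,
    Finset.mem_image, Finset.mem_filter, Finset.mem_univ, true_and]
  constructor
  · rintro ⟨⟨i, rfl⟩, h⟩
    exact ⟨i, h, rfl⟩
  · rintro ⟨i, h, rfl⟩
    exact ⟨⟨i, rfl⟩, h⟩

theorem ncard_neighborSet_inter (S : Finset (Fin d → Bool)) (v : Fin d → Bool) :
    ((hypercube d).neighborSet v ∩ (S : Set (Fin d → Bool))).ncard = degIn S v := by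
  rw [neighborSet_inter_eq, Set.ncard_coe_finset,
    Finset.card_image_of_injective _ (flipAt_index_injective v), degIn]

theorem isOddIndepSet_hypercube_iff {S : Finset (Fin d → Bool)} :
    IsOddIndepSet (hypercube d) S ↔
      (∀ v ∈ S, ∀ i, flipAt v i ∉ S) ∧ ∀ v ∉ S, degIn S v = 0 ∨ Odd (degIn S v) := by
  unfold IsOddIndepSet
  refine and_congr ⟨fun h v hv i hi => ?_, fun h v hv w hw _ hadj => ?_⟩ ?_
  · have hadj : (hypercube d).Adj v (flipAt v i) := hypercube_adj_iff.2 ⟨i, rfl⟩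
    exact h hv hi hadj.ne hadj
  · obtain ⟨i, rfl⟩ := hypercube_adj_iff.1 hadj
    exact h v hv i hw
  · refine forall₂_congr fun v _ => ?_
    rw [← Set.ncard_eq_zero (Set.toFinite _), ncard_neighborSet_inter]

/-- Both sides count the edges between `A` and `B`, sorted by direction; each flip is a bijection
exchanging the roles of the endpoints. -/
theorem sum_degIn_comm (A B : Finset (Fin d → Bool)) :
    ∑ v ∈ A, degIn B v = ∑ v ∈ B, degIn A v := by
  have key : ∀ A B : Finset (Fin d → Bool), ∑ v ∈ A, degIn B v =
      ∑ i, ∑ v, if v ∈ A ∧ flipAt v i ∈ B then 1 else 0 := by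
    intro A B
    simp_rw [degIn_eq_sum]
    rw [Finset.sum_comm]
    refine Finset.sum_congr rfl fun i _ => ?_
    rw [← Finset.sum_filter_add_sum_filter_not Finset.univ (· ∈ A)]
    simp [ite_and]
  rw [key, key]
  refine Finset.sum_congr rfl fun i _ => ?_
  refine Fintype.sum_equiv (flipEquiv i) _ _ fun v => ?_
  simp [flipEquiv, flipAt_flipAt, and_comm]

end Flip

/-! ### Parity and double counting in even dimension -/

section UpperBound

variable {d : ℕ} {S : Finset (Fin d → Bool)}

/-- The vertices with a neighbour in `S`. -/
def touched (S : Finset (Fin d → Bool)) : Finset (Fin d → Bool) :=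
  Finset.univ.filter fun v => 0 < degIn S v

/-- The vertices outside `S` with no neighbour in `S`. -/
def untouched (S : Finset (Fin d → Bool)) : Finset (Fin d → Bool) :=
  Finset.univ.filter fun v => v ∉ S ∧ degIn S v = 0

theorem mem_touched {v : Fin d → Bool} : v ∈ touched S ↔ 0 < degIn S v := by
  simp [touched]

theorem mem_untouched {v : Fin d → Bool} : v ∈ untouched S ↔ v ∉ S ∧ degIn S v = 0 := by
  simp [untouched]

theorem degIn_eq_zero_of_mem (h : IsOddIndepSet (hypercube d) S) {v : Fin d → Bool}
    (hv : v ∈ S) : degIn S v = 0 := by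
  by_contra h0
  obtain ⟨i, hi⟩ := degIn_pos_iff.1 (Nat.pos_of_ne_zero h0)
  exact (isOddIndepSet_hypercube_iff.1 h).1 v hv i hi

theorem notMem_of_mem_touched (h : IsOddIndepSet (hypercube d) S) {v : Fin d → Bool}
    (hv : v ∈ touched S) : v ∉ S := fun hS =>
  (mem_touched.1 hv).ne' (degIn_eq_zero_of_mem h hS)

theorem odd_degIn_of_mem_touched (h : IsOddIndepSet (hypercube d) S) {v : Fin d → Bool}
    (hv : v ∈ touched S) : Odd (degIn S v) :=
  ((isOddIndepSet_hypercube_iff.1 h).2 v (notMem_of_mem_touched h hv)).resolve_left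
    (mem_touched.1 hv).ne'

theorem sum_partition (h : IsOddIndepSet (hypercube d) S) (g : (Fin d → Bool) → ℕ) :
    ∑ v ∈ S, g v + ∑ v ∈ touched S, g v + ∑ v ∈ untouched S, g v = ∑ v, g v := by
  rw [← Finset.sum_union, ← Finset.sum_union]
  · congr 1
    ext v
    simp only [Finset.mem_union, mem_touched, mem_untouched, Finset.mem_univ, iff_true]
    by_cases hv : v ∈ S
    · simp [hv]
    · simp [hv]; omega
  · rw [Finset.disjoint_left]
    intro v hv hu
    rw [mem_untouched] at hu
    rcases Finset.mem_union.1 hv with hv | hv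
    · exact hu.1 hv
    · exact (mem_touched.1 hv).ne' hu.2
  · rw [Finset.disjoint_left]
    exact fun v hv ht => notMem_of_mem_touched h ht hv

theorem card_partition (h : IsOddIndepSet (hypercube d) S) :
    S.card + (touched S).card + (untouched S).card = 2 ^ d := by
  simpa using sum_partition h (fun _ => 1)

theorem degIn_partition (h : IsOddIndepSet (hypercube d) S) (v : Fin d → Bool) :
    degIn S v + degIn (touched S) v + degIn (untouched S) v = d := by
  have hcard : ∀ A : Finset (Fin d → Bool),
      degIn A v = ∑ w ∈ A, if w ∈ Finset.univ.image (flipAt v) then 1 else 0 := by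
    intro A
    rw [← Finset.card_filter, degIn,
      ← Finset.card_image_of_injective _ (flipAt_index_injective v)]
    congr 1
    ext w
    simp only [Finset.mem_image, Finset.mem_filter, Finset.mem_univ, true_and]
    constructor
    · rintro ⟨i, hi, rfl⟩
      exact ⟨hi, i, rfl⟩
    · rintro ⟨hw, i, rfl⟩
      exact ⟨i, hw, rfl⟩
  rw [hcard, hcard, hcard, sum_partition h, ← Finset.card_filter, Finset.filter_univ_mem,
    Finset.card_image_of_injective _ (flipAt_index_injective v), Finset.card_univ,
    Fintype.card_fin]

theorem sum_touched_degIn (S : Finset (Fin d → Bool)) :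
    ∑ v ∈ touched S, degIn S v = d * S.card := by
  rw [sum_degIn_comm, Finset.sum_const_nat (m := d), mul_comm]
  intro v hv
  rw [degIn, Finset.filter_true_of_mem, Finset.card_univ, Fintype.card_fin]
  intro i _
  rw [mem_touched, degIn_pos_iff]
  exact ⟨i, by rwa [flipAt_flipAt]⟩

/-- Modulo 2, being touched equals the degree into `S`, so the left side counts the pairs (i, j)
with v + e_i + e_j in `S`. Swapping i and j pairs them off; the diagonal contributes nothing because
v + e_i + e_i = v is not in `S`. -/
theorem even_degIn_touched (h : IsOddIndepSet (hypercube d) S) {v : Fin d → Bool}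
    (hv : v ∈ touched S) : Even (degIn (touched S) v) := by
  have hvS := notMem_of_mem_touched h hv
  rw [← ZMod.natCast_eq_zero_iff_even, degIn_eq_sum]
  have h1 : ∀ i, ((if flipAt v i ∈ touched S then 1 else 0 : ℕ) : ZMod 2) =
      ∑ j, if flipAt (flipAt v i) j ∈ S then 1 else 0 := by
    intro i
    have h2 : ((degIn S (flipAt v i) : ℕ) : ZMod 2) =
      ∑ j, if flipAt (flipAt v i) j ∈ S then 1 else 0 := by
      rw [degIn_eq_sum]; push_cast; rfl
    rw [← h2]
    split_ifs with ht
    · rw [Nat.cast_one, eq_comm, ZMod.natCast_eq_one_iff_odd]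
      exact odd_degIn_of_mem_touched h ht
    · rw [mem_touched, Nat.pos_iff_ne_zero, not_not] at ht
      rw [ht]
  rw [Nat.cast_sum, Finset.sum_congr rfl fun i _ => h1 i, ← Fintype.sum_prod_type']
  refine Finset.sum_involution (fun p _ => p.swap) ?_ ?_ ?_ ?_
  · rintro ⟨i, j⟩ -
    simp only [Prod.swap_prod_mk, flipAt_comm v j i]
    exact CharTwo.add_self_eq_zero _
  · rintro ⟨i, j⟩ - h0 heq
    obtain rfl : j = i := congrArg Prod.fst heq
    simp [flipAt_flipAt, hvS] at h0
  · simp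
  · simp

theorem card_touched_le (hd : Even d) (h : IsOddIndepSet (hypercube d) S) :
    (touched S).card ≤ d * (untouched S).card := by
  calc (touched S).card = ∑ v ∈ touched S, 1 := by simp
    _ ≤ ∑ v ∈ touched S, degIn (untouched S) v := by
      refine Finset.sum_le_sum fun v hv => ?_
      have h1 := odd_degIn_of_mem_touched h hv
      have h2 := even_degIn_touched h hv
      have h3 := degIn_partition h v
      -- With no untouched neighbour, d would be odd plus even.
      by_contra hlt
      have h4 : degIn (untouched S) v = 0 := by omega
      rw [h4, add_zero] at h3
      exact Nat.not_even_iff_odd.2 (h1.add_even h2) (h3.symm ▸ hd)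
    _ = ∑ v ∈ untouched S, degIn (touched S) v := sum_degIn_comm _ _
    _ ≤ ∑ v ∈ untouched S, d := Finset.sum_le_sum fun v _ => degIn_le _ _
    _ = d * (untouched S).card := by rw [Finset.sum_const, smul_eq_mul, mul_comm]

theorem degIn_lt_of_mem_touched (hd : Even d) (h : IsOddIndepSet (hypercube d) S)
    {v : Fin d → Bool} (hv : v ∈ touched S) : degIn S v + 1 ≤ d := by
  have h1 := odd_degIn_of_mem_touched h hv
  refine lt_of_le_of_ne (degIn_le S v) fun heq => ?_
  exact Nat.not_even_iff_odd.2 h1 (heq.symm ▸ hd)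

theorem mul_card_add_card_touched_le (hd : Even d) (h : IsOddIndepSet (hypercube d) S) :
    d * S.card + (touched S).card ≤ d * (touched S).card := by
  rw [← sum_touched_degIn S, Finset.card_eq_sum_ones, ← Finset.sum_add_distrib,
    ← Finset.card_eq_sum_ones, mul_comm d]
  exact Finset.sum_le_card_nsmul _ _ _ fun v hv => degIn_lt_of_mem_touched hd h hv

end UpperBound

/-! ### The sharper bound in dimension six -/

section CubeSix

variable {S : Finset (Fin 6 → Bool)}

/-- Translation by e_i + e_j is a fixed-point-free involution that exchanges the two conditions. -/
theorem even_card_common {d : ℕ} (S : Finset (Fin d → Bool)) {i j : Fin d} (hij : i ≠ j) :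
    Even (Finset.univ.filter fun v => flipAt v i ∈ S ∧ flipAt v j ∈ S).card := by
  rw [← ZMod.natCast_eq_zero_iff_even, Finset.card_filter, Nat.cast_sum]
  refine Finset.sum_involution (fun v _ => flipAt (flipAt v i) j) ?_ ?_ ?_ ?_
  · intro v _
    have h1 : flipAt (flipAt (flipAt v i) j) i = flipAt v j := by
      rw [flipAt_comm, flipAt_flipAt]
    rw [h1, flipAt_flipAt]
    simp only [and_comm (a := flipAt v j ∈ S) (b := flipAt v i ∈ S)]
    exact CharTwo.add_self_eq_zero _
  · intro v _ _ h
    have := congrFun h i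
    simp [flipAt, hij] at this
  · simp
  · intro v _
    rw [flipAt_comm (flipAt v i) j i, flipAt_flipAt, flipAt_flipAt]

theorem sum_sq_degIn {d : ℕ} (S : Finset (Fin d → Bool)) :
    ∑ v, degIn S v ^ 2 =
      ∑ i, ∑ j, (Finset.univ.filter fun v => flipAt v i ∈ S ∧ flipAt v j ∈ S).card := by
  simp_rw [Finset.card_filter, degIn_eq_sum, sq, Finset.sum_mul_sum]
  rw [Finset.sum_comm]
  refine Finset.sum_congr rfl fun i _ => ?_
  rw [Finset.sum_comm]
  refine Finset.sum_congr rfl fun j _ => Finset.sum_congr rfl fun v _ => ?_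
  by_cases hi : flipAt v i ∈ S <;> simp [hi]

theorem card_filter_flipAt_mem {d : ℕ} (S : Finset (Fin d → Bool)) (i : Fin d) :
    (Finset.univ.filter fun v => flipAt v i ∈ S).card = S.card := by
  rw [← Finset.card_image_of_injective S (flipAt_injective i)]
  congr 1
  ext v
  simp only [Finset.mem_filter, Finset.mem_univ, true_and, Finset.mem_image]
  constructor
  · exact fun h => ⟨_, h, flipAt_flipAt v i⟩
  · rintro ⟨w, hw, rfl⟩
    rwa [flipAt_flipAt]

/-- The sum of squared degrees is computed twice modulo 4. Degrees are odd or zero, so it is the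
number of touched vertices. Expanded over pairs of directions, the diagonal gives 6|S|, and each
off-diagonal term is even and occurs twice. -/
theorem card_touched_modEq (h : IsOddIndepSet (hypercube 6) S) :
    (touched S).card ≡ 2 * S.card [MOD 4] := by
  have h1 : ∑ v, degIn S v ^ 2 ≡ (touched S).card [MOD 4] := by
    rw [touched, Finset.card_filter]
    refine Nat.ModEq.sum fun v _ => ?_
    split_ifs with hv
    · obtain ⟨m, hm⟩ := odd_degIn_of_mem_touched h (mem_touched.2 hv)
      rw [hm, show (2 * m + 1) ^ 2 = 1 + 4 * (m * m + m) by ring]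
      simp [Nat.ModEq]
    · rw [Nat.pos_iff_ne_zero, not_not] at hv
      rw [hv]; rfl
  refine h1.symm.trans ?_
  rw [sum_sq_degIn]
  set c : Fin 6 → Fin 6 → ℕ := fun i j =>
    (Finset.univ.filter fun v => flipAt v i ∈ S ∧ flipAt v j ∈ S).card with hc
  have hdiag : ∀ i, c i i = S.card := fun i => by
    simp only [hc, and_self]
    exact card_filter_flipAt_mem S i
  have hsymm : ∀ i j, c i j = c j i := fun i j => by simp only [hc, and_comm]
  have heven : ∀ i j, i ≠ j → c i j % 2 = 0 := fun i j hij =>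
    Nat.even_iff.1 (even_card_common S hij)
  change ∑ i, ∑ j, c i j ≡ _ [MOD 4]
  clear_value c
  simp only [Fin.sum_univ_six, hdiag]
  rw [hsymm 1 0, hsymm 2 0, hsymm 3 0, hsymm 4 0, hsymm 5 0, hsymm 2 1, hsymm 3 1, hsymm 4 1,
    hsymm 5 1, hsymm 3 2, hsymm 4 2, hsymm 5 2, hsymm 4 3, hsymm 5 3, hsymm 5 4]
  have h01 := heven 0 1 (by decide)
  have h02 := heven 0 2 (by decide)
  have h03 := heven 0 3 (by decide)
  have h04 := heven 0 4 (by decide)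
  have h05 := heven 0 5 (by decide)
  have h12 := heven 1 2 (by decide)
  have h13 := heven 1 3 (by decide)
  have h14 := heven 1 4 (by decide)
  have h15 := heven 1 5 (by decide)
  have h23 := heven 2 3 (by decide)
  have h24 := heven 2 4 (by decide)
  have h25 := heven 2 5 (by decide)
  have h34 := heven 3 4 (by decide)
  have h35 := heven 3 5 (by decide)
  have h45 := heven 4 5 (by decide)
  unfold Nat.ModEq
  omega

/-- The vertices with a neighbour in `S`, but not exactly five of them. -/
def deficient (S : Finset (Fin 6 → Bool)) : Finset (Fin 6 → Bool) :=
  (touched S).filter fun v => degIn S v ≠ 5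

theorem six_mul_card_add_two_mul_card_deficient_le (h : IsOddIndepSet (hypercube 6) S) :
    6 * S.card + 2 * (deficient S).card ≤ 5 * (touched S).card := by
  rw [← sum_touched_degIn S, deficient, Finset.card_filter, Finset.mul_sum,
    ← Finset.sum_add_distrib, mul_comm 5]
  refine Finset.sum_le_card_nsmul _ _ _ fun v hv => ?_
  have h1 := degIn_lt_of_mem_touched (by decide) h hv
  obtain ⟨m, hm⟩ := odd_degIn_of_mem_touched h hv
  split_ifs <;> omega

theorem exists_unique_missing {v : Fin 6 → Bool} (hv : degIn S v = 5) :
    ∃ i, ∀ j, flipAt v j ∉ S ↔ j = i := by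
  have h1 := Finset.card_filter_add_card_filter_not (s := (Finset.univ : Finset (Fin 6)))
    (fun i => flipAt v i ∈ S)
  have h2 : (Finset.univ.filter fun i => flipAt v i ∈ S).card = 5 := hv
  rw [h2, Finset.card_univ, Fintype.card_fin] at h1
  obtain ⟨i, hi⟩ := Finset.card_eq_one.1
    (show (Finset.univ.filter fun i => ¬ flipAt v i ∈ S).card = 1 by omega)
  refine ⟨i, fun j => ?_⟩
  have := Finset.ext_iff.1 hi j
  simpa using this

theorem mem_of_missing {v : Fin 6 → Bool} (hv : degIn S v = 5) {i j : Fin 6}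
    (hi : flipAt v i ∉ S) (hij : j ≠ i) : flipAt v j ∈ S := by
  obtain ⟨k, hk⟩ := exists_unique_missing hv
  by_contra hj
  exact hij (((hk j).1 hj).trans ((hk i).1 hi).symm)

/-- The vertex obtained from `x` by flipping three coordinates. -/
def flipThree (x : Fin 6 → Bool) (i j k : Fin 6) : Fin 6 → Bool := flipAt (flipAt (flipAt x i) j) k

/-- If the distance-two neighbours `x + e_i + e_j` missing from `S` are given by the perfect
matching `{a, a'}, {b, b'}, {c, c'}`, then one of the vertices `x + e_a + e_a' + e_b`,
`x + e_b + e_b' + e_c`, `x + e_c + e_c' + e_a` is deficient: otherwise all neighbours of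
`x + e_a + e_b + e_c` lie in `S`. -/
theorem exists_deficient (h : IsOddIndepSet (hypercube 6) S) {x : Fin 6 → Bool}
    {a a' b b' c c' : Fin 6} (hcover : ∀ j, j = a ∨ j = a' ∨ j = b ∨ j = b' ∨ j = c ∨ j = c')
    (hab : a ≠ b) (hbc : b ≠ c) (hca : c ≠ a)
    (haa : flipAt (flipAt x a) a' ∉ S) (hbb : flipAt (flipAt x b) b' ∉ S)
    (hcc : flipAt (flipAt x c) c' ∉ S) (mab : flipAt (flipAt x a) b ∈ S)
    (mbc : flipAt (flipAt x b) c ∈ S) (mca : flipAt (flipAt x c) a ∈ S) :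
    flipThree x a a' b ∈ deficient S ∨ flipThree x b b' c ∈ deficient S ∨
      flipThree x c c' a ∈ deficient S := by
  have key : ∀ p p' q r : Fin 6, q ≠ r → flipAt (flipAt x p) p' ∉ S →
      flipAt (flipAt x p) q ∈ S → flipThree x p p' q ∉ deficient S →
      flipAt (flipThree x p p' q) r ∈ S := by
    intro p p' q r hqr hpp hpq hdef
    have ht : flipThree x p p' q ∈ touched S := by
      rw [mem_touched, degIn_pos_iff]
      refine ⟨p', ?_⟩
      rwa [flipThree, flipAt_comm (flipAt x p) p' q, flipAt_flipAt]
    have h5 : degIn S (flipThree x p p' q) = 5 := by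
      by_contra hne
      exact hdef (Finset.mem_filter.2 ⟨ht, hne⟩)
    refine mem_of_missing h5 (i := q) ?_ hqr.symm
    rwa [flipThree, flipAt_flipAt]
  by_contra! hcon
  have h1 := key a a' b c hbc haa mab hcon.1
  have h2 := key b b' c a hca hbb mbc hcon.2.1
  have h3 := key c c' a b hab hcc mca hcon.2.2
  -- Three neighbours of w are at distance two from x; the other three, in directions a', b', c',
  -- come from `h1`, `h2`, `h3`. Degree 6 is even, which is impossible.
  set w := flipThree x a b c with hw
  have hall : ∀ j, flipAt w j ∈ S := by
    intro j
    rcases hcover j with rfl | rfl | rfl | rfl | rfl | rfl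
    · rw [hw, flipThree, flipAt_comm _ c, flipAt_comm _ b, flipAt_flipAt]; exact mbc
    · convert h1 using 1
      funext t
      simp only [hw, flipThree, flipAt, Bool.xor_assoc, Bool.xor_comm, Bool.xor_left_comm]
    · rw [hw, flipThree, flipAt_comm _ c, flipAt_flipAt, flipAt_comm]; exact mca
    · convert h2 using 1
      funext t
      simp only [hw, flipThree, flipAt, Bool.xor_assoc, Bool.xor_comm, Bool.xor_left_comm]
    · rw [hw, flipThree, flipAt_flipAt]; exact mab
    · convert h3 using 1
      funext t
      simp only [hw, flipThree, flipAt, Bool.xor_assoc, Bool.xor_comm, Bool.xor_left_comm]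
  have h6 : degIn S w = 6 := by
    rw [degIn, Finset.filter_true_of_mem fun j _ => hall j]; rfl
  have hwt : w ∈ touched S := by rw [mem_touched, h6]; norm_num
  have := odd_degIn_of_mem_touched h hwt
  rw [h6] at this
  exact absurd this (by decide)

theorem exists_equiv_of_fixedPointFree_involution {μ : Fin 6 → Fin 6} (hinv : ∀ i, μ (μ i) = i)
    (hfix : ∀ i, μ i ≠ i) : ∃ e : Fin 6 ≃ Fin 6, ∀ i, μ (e i) = e (![1, 0, 3, 2, 5, 4] i) := by
  obtain ⟨a, b, c, hab, hab', hac, hac', hbc, hbc'⟩ :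
      ∃ a b c : Fin 6, b ≠ a ∧ b ≠ μ a ∧ c ≠ a ∧ c ≠ μ a ∧ c ≠ b ∧ c ≠ μ b := by
    obtain ⟨b, hb⟩ : ∃ b, b ∉ ({0, μ 0} : Finset (Fin 6)) := by
      by_contra! hcon
      have := (Finset.card_le_card fun t _ => hcon t : (Finset.univ : Finset (Fin 6)).card ≤ _)
      have h2 : ({0, μ 0} : Finset (Fin 6)).card ≤ 2 := Finset.card_le_two
      rw [Finset.card_univ, Fintype.card_fin] at this
      omega
    obtain ⟨c, hc⟩ : ∃ c, c ∉ ({0, μ 0, b, μ b} : Finset (Fin 6)) := by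
      by_contra! hcon
      have := (Finset.card_le_card fun t _ => hcon t : (Finset.univ : Finset (Fin 6)).card ≤ _)
      have h2 : ({0, μ 0, b, μ b} : Finset (Fin 6)).card ≤ 4 := Finset.card_le_four
      rw [Finset.card_univ, Fintype.card_fin] at this
      omega
    simp only [Finset.mem_insert, Finset.mem_singleton, not_or] at hb hc
    exact ⟨0, b, c, hb.1, hb.2, hc.1, hc.2.1, hc.2.2.1, hc.2.2.2⟩
  have hinj : Function.Injective μ := Function.LeftInverse.injective hinv
  have hab'' : μ b ≠ a := fun e => hab' (by rw [← e, hinv])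
  have hac'' : μ c ≠ a := fun e => hac' (by rw [← e, hinv])
  have hbc'' : μ c ≠ b := fun e => hbc' (by rw [← e, hinv])
  have hcard : ({a, μ a, b, μ b, c, μ c} : Finset (Fin 6)).card = 6 := by
    simp [Finset.card_insert_of_notMem, hab.symm, hab'.symm, hab''.symm, hac.symm, hac'.symm,
      hac''.symm, hbc.symm, hbc'.symm, hbc''.symm, (hfix a).symm, (hfix b).symm, (hfix c).symm,
      (hinj.ne hab).symm, (hinj.ne hac).symm, (hinj.ne hbc).symm]
  have huniv : ({a, μ a, b, μ b, c, μ c} : Finset (Fin 6)) = Finset.univ :=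
    Finset.eq_univ_of_card _ (by simpa using hcard)
  have hsurj : Function.Surjective ![a, μ a, b, μ b, c, μ c] := by
    intro j
    have hj := Finset.mem_univ j
    rw [← huniv] at hj
    simp only [Finset.mem_insert, Finset.mem_singleton] at hj
    rcases hj with rfl | rfl | rfl | rfl | rfl | rfl
    exacts [⟨0, rfl⟩, ⟨1, rfl⟩, ⟨2, rfl⟩, ⟨3, rfl⟩, ⟨4, rfl⟩, ⟨5, rfl⟩]
  refine ⟨Equiv.ofBijective _ ⟨Finite.injective_iff_surjective.2 hsurj, hsurj⟩, fun i => ?_⟩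
  fin_cases i
  exacts [rfl, hinv a, rfl, hinv b, rfl, hinv c]

/-- Each neighbour x + e_i misses `S` in one direction μ i. Since x + e_i + e_j is symmetric in i, j
and x lies in `S`, μ is a fixed-point-free involution, that is, a perfect matching of the
coordinates. Three choices of representatives for `exists_deficient` have disjoint lists of
candidates. -/
theorem three_le_card_deficient (h : IsOddIndepSet (hypercube 6) S) {x : Fin 6 → Bool}
    (hx : x ∈ S) (hfull : ∀ i, degIn S (flipAt x i) = 5) : 3 ≤ (deficient S).card := by
  choose μ hμ using fun i => exists_unique_missing (hfull i)
  have hnot : ∀ i, flipAt (flipAt x i) (μ i) ∉ S := fun i => (hμ i _).2 rfl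
  obtain ⟨e, he⟩ := exists_equiv_of_fixedPointFree_involution (μ := μ)
    (fun i => ((hμ (μ i) i).1 (by rw [flipAt_comm]; exact hnot i)).symm)
    (fun i hi => by
      have := hnot i
      rw [hi, flipAt_flipAt] at this
      exact this hx)
  have hmissing : ∀ i j, j = ![1, 0, 3, 2, 5, 4] i → flipAt (flipAt x (e i)) (e j) ∉ S := by
    rintro i _ rfl
    rw [← he]
    exact hnot _
  have hmem : ∀ i j, j ≠ ![1, 0, 3, 2, 5, 4] i → flipAt (flipAt x (e i)) (e j) ∈ S := by
    intro i j hj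
    by_contra hn
    have := (hμ _ _).1 hn
    rw [he] at this
    exact hj (e.injective this)
  have hdef : ∀ a a' b b' c c' : Fin 6,
      (∀ j, j = a ∨ j = a' ∨ j = b ∨ j = b' ∨ j = c ∨ j = c') → a ≠ b → b ≠ c → c ≠ a →
      a' = ![1, 0, 3, 2, 5, 4] a → b' = ![1, 0, 3, 2, 5, 4] b → c' = ![1, 0, 3, 2, 5, 4] c →
      b ≠ ![1, 0, 3, 2, 5, 4] a → c ≠ ![1, 0, 3, 2, 5, 4] b → a ≠ ![1, 0, 3, 2, 5, 4] c →
      flipThree x (e a) (e a') (e b) ∈ deficient S ∨ flipThree x (e b) (e b') (e c) ∈ deficient S ∨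
        flipThree x (e c) (e c') (e a) ∈ deficient S := by
    intro a a' b b' c c' hcover hab hbc hca ha hb hc mab mbc mca
    refine exists_deficient h (fun j => ?_) (e.injective.ne hab) (e.injective.ne hbc)
      (e.injective.ne hca) (hmissing _ _ ha) (hmissing _ _ hb) (hmissing _ _ hc) (hmem _ _ mab)
      (hmem _ _ mbc) (hmem _ _ mca)
    simpa [← Equiv.symm_apply_eq] using hcover (e.symm j)
  -- Translating x to the origin and relabelling by `e` makes the candidates concrete, so that
  -- `decide` separates them.
  let g : (Fin 6 → Bool) → Fin 6 → Bool := fun v t => xor (v (e t)) (x (e t))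
  have hg : ∀ i j k, g (flipThree x (e i) (e j) (e k)) = flipThree (fun _ => false) i j k := by
    intro i j k
    have hxor : ∀ p q r s : Bool,
        xor (xor (xor (xor p q) r) s) p = xor (xor (xor false q) r) s := by decide
    funext t
    simp only [g, flipThree, flipAt, hxor, e.injective.eq_iff]
  have hpattern : ∀ {a a' b b' c c' : Fin 6},
      (flipThree x (e a) (e a') (e b) ∈ deficient S ∨ flipThree x (e b) (e b') (e c) ∈ deficient S ∨
        flipThree x (e c) (e c') (e a) ∈ deficient S) →
      ∃ p ∈ deficient S, g p = flipThree (fun _ => false) a a' b ∨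
        g p = flipThree (fun _ => false) b b' c ∨ g p = flipThree (fun _ => false) c c' a := by
    rintro a a' b b' c c' (hp | hp | hp)
    exacts [⟨_, hp, Or.inl (hg _ _ _)⟩, ⟨_, hp, Or.inr (Or.inl (hg _ _ _))⟩,
      ⟨_, hp, Or.inr (Or.inr (hg _ _ _))⟩]
  -- For the matching 01|23|45 the candidate triples are 012, 234, 450; then 103, 325, 541; then
  -- 014, 452, 230: nine different sets.
  obtain ⟨p, hp, ep⟩ := hpattern (hdef 0 1 2 3 4 5 (by decide) (by decide) (by decide) (by decide)
    rfl rfl rfl (by decide) (by decide) (by decide))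
  obtain ⟨q, hq, eq⟩ := hpattern (hdef 1 0 3 2 5 4 (by decide) (by decide) (by decide) (by decide)
    rfl rfl rfl (by decide) (by decide) (by decide))
  obtain ⟨r, hr, er⟩ := hpattern (hdef 0 1 4 5 2 3 (by decide) (by decide) (by decide) (by decide)
    rfl rfl rfl (by decide) (by decide) (by decide))
  have hpq : p ≠ q := by
    rintro rfl
    rcases ep with ep | ep | ep <;> rw [ep] at eq <;> revert eq <;> decide
  have hpr : p ≠ r := by
    rintro rfl
    rcases ep with ep | ep | ep <;> rw [ep] at er <;> revert er <;> decide
  have hqr : q ≠ r := by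
    rintro rfl
    rcases eq with eq | eq | eq <;> rw [eq] at er <;> revert er <;> decide
  have hsub : ({p, q, r} : Finset (Fin 6 → Bool)) ⊆ deficient S := by
    simp [Finset.insert_subset_iff, hp, hq, hr]
  have := Finset.card_le_card hsub
  rwa [Finset.card_eq_three.2 ⟨p, q, r, hpq, hpr, hqr, rfl⟩] at this

theorem card_le_of_isOddIndepSet_hypercube_six (h : IsOddIndepSet (hypercube 6) S) :
    S.card ≤ 24 := by
  have h1 := card_partition h
  have h2 := card_touched_le (by decide) h
  have h3 := six_mul_card_add_two_mul_card_deficient_le h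
  have h4 := card_touched_modEq h
  unfold Nat.ModEq at h4
  norm_num at h1
  by_contra! hcon
  -- Only (|S|, |T|) = (25, 30) and (26, 32) survive, with at most 0 and 2 deficient vertices.
  have hdef : (deficient S).card ≤ 2 := by omega
  -- Two deficient vertices have at most 12 neighbours, fewer than |S|.
  have hlt : ((deficient S).biUnion fun v => Finset.univ.image (flipAt v)).card < S.card := by
    refine lt_of_le_of_lt (Finset.card_biUnion_le_card_mul _ _ 6 fun v _ => ?_) (by omega)
    exact Finset.card_image_le
  obtain ⟨x, hx, hx'⟩ := Finset.exists_mem_notMem_of_card_lt_card hlt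
  have := three_le_card_deficient h hx fun i => by
    by_contra hne
    refine hx' (Finset.mem_biUnion.2 ⟨flipAt x i, Finset.mem_filter.2 ⟨?_, hne⟩,
      Finset.mem_image.2 ⟨i, Finset.mem_univ _, flipAt_flipAt x i⟩⟩)
    rw [mem_touched, degIn_pos_iff]
    exact ⟨i, by rwa [flipAt_flipAt]⟩
  omega

end CubeSix

theorem le_oddIndepNum {V : Type*} [Fintype V] {G : SimpleGraph V} {S : Finset V}
    (h : IsOddIndepSet G S) : S.card ≤ oddIndepNum G :=
  (oddIndepNum_isGreatest G).2 ⟨S, h, rfl⟩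

/-! ### Raising the dimension by two at constant density -/

section Extension

variable {d : ℕ}

/-- Replaces the first three coordinates by their sum. -/
def mergeThree (v : Fin (d + 3) → Bool) : Fin (d + 1) → Bool :=
  Fin.cons (xor (v 0) (xor (v 1) (v 2))) fun j => v j.succ.succ.succ

theorem mergeThree_flipAt_zero (v : Fin (d + 3) → Bool) :
    mergeThree (flipAt v 0) = flipAt (mergeThree v) 0 := by
  funext j
  refine Fin.cases ?_ (fun j => ?_) j
  · have h1 : (1 : Fin (d + 3)) ≠ 0 := by simp
    have h2 : (2 : Fin (d + 3)) ≠ 0 := by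
      simp [Fin.ext_iff, Nat.mod_eq_of_lt (show 2 < d + 3 by omega)]
    simp [mergeThree, flipAt, h1, h2]
  · simp [mergeThree, flipAt]

theorem mergeThree_flipAt_one (v : Fin (d + 3) → Bool) :
    mergeThree (flipAt v 1) = flipAt (mergeThree v) 0 := by
  funext j
  refine Fin.cases ?_ (fun j => ?_) j
  · have h1 : (0 : Fin (d + 3)) ≠ 1 := by simp
    have h2 : (2 : Fin (d + 3)) ≠ 1 := by
      simp [Fin.ext_iff, Nat.mod_eq_of_lt (show 2 < d + 3 by omega)]
    simp [mergeThree, flipAt, h1, h2]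
  · have : j.succ.succ.succ ≠ (1 : Fin (d + 3)) := by simp [Fin.ext_iff]
    simp [mergeThree, flipAt, this]

theorem mergeThree_flipAt_two (v : Fin (d + 3) → Bool) :
    mergeThree (flipAt v 2) = flipAt (mergeThree v) 0 := by
  funext j
  refine Fin.cases ?_ (fun j => ?_) j
  · have h1 : (0 : Fin (d + 3)) ≠ 2 := by
      simp [Fin.ext_iff, Nat.mod_eq_of_lt (show 2 < d + 3 by omega)]
    have h2 : (1 : Fin (d + 3)) ≠ 2 := by
      simp [Fin.ext_iff, Nat.mod_eq_of_lt (show 2 < d + 3 by omega)]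
    simp [mergeThree, flipAt, h1, h2]
  · have : j.succ.succ.succ ≠ (2 : Fin (d + 3)) := by
      simp [Fin.ext_iff, Nat.mod_eq_of_lt (show 2 < d + 1 + 1 + 1 by omega)]
    simp [mergeThree, flipAt, this]

theorem mergeThree_flipAt_succ (v : Fin (d + 3) → Bool) (i : Fin d) :
    mergeThree (flipAt v i.succ.succ.succ) = flipAt (mergeThree v) i.succ := by
  funext j
  refine Fin.cases ?_ (fun j => ?_) j
  · have h0 : (0 : Fin (d + 3)) ≠ i.succ.succ.succ := by simp [Fin.ext_iff]
    have h1 : (1 : Fin (d + 3)) ≠ i.succ.succ.succ := by simp [Fin.ext_iff]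
    have h2 : (2 : Fin (d + 3)) ≠ i.succ.succ.succ := by
      simp [Fin.ext_iff, Nat.mod_eq_of_lt (show 2 < d + 3 by omega)]
    have h3 : (0 : Fin (d + 1)) ≠ i.succ := by simp [Fin.ext_iff]
    simp [mergeThree, flipAt, h0, h1, h2, h3]
  · simp [mergeThree, flipAt]

/-- The preimage of `S` under `mergeThree`. -/
def splitThree (S : Finset (Fin (d + 1) → Bool)) : Finset (Fin (d + 3) → Bool) :=
  Finset.univ.filter fun v => mergeThree v ∈ S

theorem mem_splitThree {S : Finset (Fin (d + 1) → Bool)} {v : Fin (d + 3) → Bool} :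
    v ∈ splitThree S ↔ mergeThree v ∈ S := by
  simp [splitThree]

/-- Three directions upstairs project to direction 0 downstairs, so that neighbour is counted two
extra times. This keeps parity, and keeps degree zero. -/
theorem degIn_splitThree (S : Finset (Fin (d + 1) → Bool)) (v : Fin (d + 3) → Bool) :
    degIn (splitThree S) v =
      degIn S (mergeThree v) + 2 * if flipAt (mergeThree v) 0 ∈ S then 1 else 0 := by
  have e1 : (Fin.succ 0 : Fin (d + 3)) = 1 := rfl
  have e2 : (Fin.succ (Fin.succ 0) : Fin (d + 3)) = 2 := rfl
  rw [degIn_eq_sum, degIn_eq_sum, Fin.sum_univ_succ, Fin.sum_univ_succ, Fin.sum_univ_succ,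
    Fin.sum_univ_succ (n := d), e1, e2]
  simp only [mem_splitThree, mergeThree_flipAt_zero, mergeThree_flipAt_one, mergeThree_flipAt_two,
    mergeThree_flipAt_succ]
  ring

theorem IsOddIndepSet.splitThree {S : Finset (Fin (d + 1) → Bool)}
    (h : IsOddIndepSet (hypercube (d + 1)) S) :
    IsOddIndepSet (hypercube (d + 3)) (splitThree S) := by
  rw [isOddIndepSet_hypercube_iff] at h ⊢
  refine ⟨fun v hv i => ?_, fun v hv => ?_⟩
  · rw [mem_splitThree] at hv ⊢
    refine Fin.cases ?_ (fun i => Fin.cases ?_ (fun i => Fin.cases ?_ (fun i => ?_) i) i) i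
    · rw [mergeThree_flipAt_zero]; exact h.1 _ hv _
    · exact mergeThree_flipAt_one v ▸ h.1 _ hv _
    · exact mergeThree_flipAt_two v ▸ h.1 _ hv _
    · rw [mergeThree_flipAt_succ]; exact h.1 _ hv _
  · rw [mem_splitThree] at hv
    rw [degIn_splitThree]
    rcases h.2 _ hv with h0 | h1
    · left
      have : flipAt (mergeThree v) 0 ∉ S := fun hm =>
        (degIn_pos_iff.2 ⟨0, hm⟩).ne' h0
      simp [h0, this]
    · right
      exact h1.add_even (even_two_mul _)

theorem four_mul_card_le_card_splitThree (S : Finset (Fin (d + 1) → Bool)) :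
    4 * S.card ≤ (splitThree S).card := by
  have hc : 4 * S.card = ((Finset.univ : Finset (Bool × Bool)) ×ˢ S).card := by
    rw [Finset.card_product]; rfl
  rw [hc]
  -- Two of the merged coordinates are free; the third is fixed by the required parity.
  refine Finset.card_le_card_of_injOn (fun p =>
    Fin.cons p.1.1 (Fin.cons p.1.2 (Fin.cons (xor p.1.1 (xor p.1.2 (p.2 0))) (Fin.tail p.2))))
    ?_ ?_
  · rintro ⟨⟨a, b⟩, x⟩ hx
    have hx : x ∈ S := by simpa using hx
    have e1 : (1 : Fin (d + 3)) = Fin.succ 0 := rfl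
    have e2 : (2 : Fin (d + 3)) = Fin.succ (Fin.succ 0) := rfl
    rw [Finset.mem_coe, mem_splitThree]
    convert hx using 1
    funext j
    refine Fin.cases ?_ (fun j => ?_) j
    · simp only [mergeThree, e1, e2, Fin.cons_zero, Fin.cons_succ]
      cases a <;> cases b <;> simp
    · simp [mergeThree, Fin.tail]
  · rintro ⟨⟨a, b⟩, x⟩ - ⟨⟨a', b'⟩, x'⟩ - h
    simp only [Fin.cons_inj] at h
    obtain ⟨rfl, rfl, h0, ht⟩ := h
    have h0' : x 0 = x' 0 := by simpa using h0
    have : x = x' := by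
      rw [← Fin.cons_self_tail x, ← Fin.cons_self_tail x', h0', ht]
    rw [this]

theorem four_mul_oddIndepNum_hypercube_le (d : ℕ) :
    4 * oddIndepNum (hypercube (d + 1)) ≤ oddIndepNum (hypercube (d + 3)) := by
  obtain ⟨S, hS, hc⟩ := (oddIndepNum_isGreatest (hypercube (d + 1))).1
  rw [← hc]
  exact (four_mul_card_le_card_splitThree S).trans (le_oddIndepNum hS.splitThree)

end Extension

/-! ### The extended Hamming code and density 7/16 -/

section Hamming

/-- Whether a word of length `8` has even weight and lies outside the extended Hamming code. -/
def isEvenNonHamming (a b c d e f g h : Bool) : Bool :=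
  !(xor a (xor b (xor c (xor d (xor e (xor f (xor g h))))))) &&
    (xor e (xor f (xor g h)) || xor c (xor d (xor g h)) || xor b (xor d (xor f h)))

/-- The vertices of even weight outside the extended Hamming code of length `8`. -/
def evenNonHamming : Finset (Fin 8 → Bool) :=
  Finset.univ.filter fun v =>
    isEvenNonHamming (v 0) (v 1) (v 2) (v 3) (v 4) (v 5) (v 6) (v 7) = true

theorem card_evenNonHamming : evenNonHamming.card = 112 := by
  decide +kernel

theorem mem_evenNonHamming {v : Fin 8 → Bool} : v ∈ evenNonHamming ↔
    isEvenNonHamming (v 0) (v 1) (v 2) (v 3) (v 4) (v 5) (v 6) (v 7) = true := by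
  simp [evenNonHamming]

/-- Even words are pairwise non-adjacent. An odd word has exactly one neighbour in the extended
Hamming code, hence 7 in the set; an even word has none. -/
theorem isOddIndepSet_evenNonHamming : IsOddIndepSet (hypercube 8) evenNonHamming := by
  rw [isOddIndepSet_hypercube_iff]
  refine ⟨fun v hv i hi => ?_, fun v _ => ?_⟩
  · rw [mem_evenNonHamming] at hv hi
    simp only [isEvenNonHamming, Bool.and_eq_true, Bool.not_eq_true'] at hv hi
    have h := hv.1.trans hi.1.symm
    fin_cases i <;> simp [flipAt] at h
  · rw [← Nat.not_even_iff_odd, degIn_eq_sum, Fin.sum_univ_eight]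
    simp only [mem_evenNonHamming, flipAt, Fin.reduceEq, decide_true, decide_false, Bool.xor_false,
      Bool.xor_true]
    generalize v 0 = a, v 1 = b, v 2 = c, v 3 = d, v 4 = e, v 5 = f, v 6 = g, v 7 = h
    revert a b c d e f g h
    decide +kernel

theorem seven_sixteenths_le_oddIndepNum {d : ℕ} (hd : Even d) (h8 : 8 ≤ d) :
    7 * 2 ^ d ≤ 16 * oddIndepNum (hypercube d) := by
  obtain ⟨m, rfl⟩ := Nat.exists_eq_add_of_le h8
  obtain ⟨r, rfl⟩ : Even m := by
    rw [Nat.even_add] at hd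
    exact hd.1 (by decide)
  clear hd h8
  induction r with
  | zero =>
    have := le_oddIndepNum isOddIndepSet_evenNonHamming
    rw [card_evenNonHamming] at this
    change 7 * 2 ^ 8 ≤ 16 * oddIndepNum (hypercube 8)
    omega
  | succ r ih =>
    have h := four_mul_oddIndepNum_hypercube_le (7 + (r + r))
    have e1 : 7 + (r + r) + 1 = 8 + (r + r) := by omega
    have e2 : 7 + (r + r) + 3 = 8 + (r + 1 + (r + 1)) := by omega
    rw [e1, e2] at h
    have e3 : 2 ^ (8 + (r + 1 + (r + 1))) = 4 * 2 ^ (8 + (r + r)) := by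
      rw [show 8 + (r + 1 + (r + 1)) = 8 + (r + r) + 2 by omega, pow_add]; ring
    rw [e3]
    omega

end Hamming

/-! ### The construction in dimension 4k -/

section MiddleLayers

/-- The weight of a vertex. -/
def weight {d : ℕ} (v : Fin d → Bool) : ℕ := ∑ i, (v i).toNat

theorem weight_flipAt_add {d : ℕ} (v : Fin d → Bool) (i : Fin d) :
    weight (flipAt v i) + 2 * (v i).toNat = weight v + 1 := by
  unfold weight
  rw [← Finset.add_sum_erase _ _ (Finset.mem_univ i),
    ← Finset.add_sum_erase Finset.univ (fun j => (v j).toNat) (Finset.mem_univ i)]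
  have : ∑ j ∈ Finset.univ.erase i, (flipAt v i j).toNat =
      ∑ j ∈ Finset.univ.erase i, (v j).toNat :=
    Finset.sum_congr rfl fun j hj => by simp [flipAt, Finset.ne_of_mem_erase hj]
  rw [this]
  cases h : v i <;> simp [flipAt, h] <;> omega

/-- The vertices of odd weight in the lower half of the cube whose first coordinate is `0`, or in
the upper half with first coordinate `1`. -/
def halfLayers (k : ℕ) (n : ℕ) : Finset (Fin (n + 1) → Bool) :=
  Finset.univ.filter fun v => weight v % 2 = 1 ∧
    (v 0 = false ∧ weight v + 1 ≤ 2 * k ∨ v 0 = true ∧ 2 * k + 1 ≤ weight v)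

theorem mem_halfLayers {k n : ℕ} {v : Fin (n + 1) → Bool} :
    v ∈ halfLayers k n ↔ weight v % 2 = 1 ∧
      (v 0 = false ∧ weight v + 1 ≤ 2 * k ∨ v 0 = true ∧ 2 * k + 1 ≤ weight v) := by
  simp [halfLayers]

theorem weight_eq_toNat_add {n : ℕ} (v : Fin (n + 1) → Bool) :
    weight v = (v 0).toNat + weight (Fin.tail v) :=
  Fin.sum_univ_succ _

/-- Written additively to avoid the truncated subtraction `n - weight y`. -/
theorem sum_ite_eq_weight {n : ℕ} (y : Fin n → Bool) (p q : ℕ) :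
    ∑ i, (if y i = true then p else q) + q * weight y = p * weight y + q * n := by
  have : ∀ i, (if y i = true then p else q) + q * (y i).toNat = p * (y i).toNat + q := by
    intro i
    cases y i <;> simp [add_comm]
  unfold weight
  rw [Finset.mul_sum, Finset.mul_sum, ← Finset.sum_add_distrib, Finset.sum_congr rfl fun i _ =>
    this i, Finset.sum_add_distrib]
  simp [mul_comm]

theorem weight_le {d : ℕ} (v : Fin d → Bool) : weight v ≤ d := by
  have : weight v ≤ ∑ _i : Fin d, 1 := Finset.sum_le_sum fun i _ => Bool.toNat_le (v i)
  simpa using this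

/-- Odd-weight vertices have only even-weight neighbours, none in the set. For v of even weight w
with first coordinate 0, the degree is 4k - 1 if w < 2k (all directions but the first), 2k + 1 if w
= 2k, and 1 if w > 2k; with first coordinate 1 the order is reversed. -/
theorem isOddIndepSet_halfLayers {k n : ℕ} (hn : n + 1 = 4 * k) :
    IsOddIndepSet (hypercube (n + 1)) (halfLayers k n) := by
  rw [isOddIndepSet_hypercube_iff]
  refine ⟨fun v hv i hi => ?_, fun v hv => ?_⟩
  · rw [mem_halfLayers] at hv hi
    have := weight_flipAt_add v i
    omega
  · by_cases hodd : weight v % 2 = 1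
    · left
      by_contra h0
      obtain ⟨i, hi⟩ := degIn_pos_iff.1 (Nat.pos_of_ne_zero h0)
      rw [mem_halfLayers] at hi
      have := weight_flipAt_add v i
      omega
    · right
      have hw := weight_eq_toNat_add v
      have hle := weight_le (Fin.tail v)
      have h0 : flipAt v 0 ∈ halfLayers k n ↔
          (v 0 = false ∧ 2 * k ≤ weight v ∨ v 0 = true ∧ weight v ≤ 2 * k) := by
        have := weight_flipAt_add v 0
        rw [mem_halfLayers]
        cases h : v 0 <;> simp [flipAt_apply, h] at this ⊢ <;> omega
      have hs : ∀ j : Fin n, (if flipAt v j.succ ∈ halfLayers k n then 1 else 0) =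
          if Fin.tail v j = true then
            (if v 0 = false ∧ weight v ≤ 2 * k ∨ v 0 = true ∧ 2 * k + 2 ≤ weight v then 1 else 0)
          else
            (if v 0 = false ∧ weight v + 2 ≤ 2 * k ∨ v 0 = true ∧ 2 * k ≤ weight v
              then 1 else 0) := by
        intro j
        have := weight_flipAt_add v j.succ
        have hne : (0 : Fin (n + 1)) ≠ j.succ := (Fin.succ_ne_zero j).symm
        have h00 : flipAt v j.succ 0 = v 0 := by
          rw [flipAt_apply, decide_eq_false hne, Bool.xor_false]
        simp only [mem_halfLayers, h00, Fin.tail]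
        obtain h | h := Bool.eq_false_or_eq_true (v 0) <;>
          obtain h' | h' := Bool.eq_false_or_eq_true (v j.succ) <;>
          simp [h, h'] at this ⊢ <;> split_ifs <;> omega
      rw [degIn_eq_sum, Fin.sum_univ_succ, Finset.sum_congr rfl fun j _ => hs j, Nat.odd_iff]
      have hsum := sum_ite_eq_weight (Fin.tail v)
        (if v 0 = false ∧ weight v ≤ 2 * k ∨ v 0 = true ∧ 2 * k + 2 ≤ weight v then 1 else 0)
        (if v 0 = false ∧ weight v + 2 ≤ 2 * k ∨ v 0 = true ∧ 2 * k ≤ weight v then 1 else 0)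
      rw [Nat.eq_sub_of_add_eq hsum]
      simp only [h0]
      obtain h | h := Bool.eq_false_or_eq_true (v 0) <;> simp [h] at hw ⊢ <;> split_ifs <;> omega

/-- The vertex with first coordinate `b` whose other coordinates are the indicator of `s`. -/
def consIndicator {n : ℕ} (b : Bool) (s : Finset (Fin n)) : Fin (n + 1) → Bool :=
  Fin.cons b fun j => decide (j ∈ s)

theorem consIndicator_injective {n : ℕ} (b : Bool) :
    Function.Injective (consIndicator (n := n) b) := by
  intro s t h
  have := (Fin.cons_inj.1 h).2
  ext j
  simpa using congrFun this j

theorem weight_consIndicator {n : ℕ} (b : Bool) (s : Finset (Fin n)) :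
    weight (consIndicator b s) = b.toNat + s.card := by
  rw [weight_eq_toNat_add]
  simp only [consIndicator, Fin.cons_zero, Fin.tail_cons, weight, Bool.toNat, Bool.cond_decide]
  simp

theorem two_mul_sum_choose_le_card_halfLayers {k n : ℕ} (hn : n + 1 = 4 * k) :
    2 * ∑ i ∈ Finset.Icc 1 k, n.choose (2 * i - 1) ≤ (halfLayers k n).card := by
  set F : Finset (Finset (Fin n)) :=
    (Finset.Icc 1 k).biUnion fun i => Finset.univ.powersetCard (2 * i - 1) with hF
  have hFcard : F.card = ∑ i ∈ Finset.Icc 1 k, n.choose (2 * i - 1) := by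
    rw [hF, Finset.card_biUnion]
    · simp
    · intro i hi j hj hij
      refine Finset.pairwise_disjoint_powersetCard _ ?_
      simp only [Finset.coe_Icc, Set.mem_Icc] at hi hj
      omega
  have hmemF : ∀ s ∈ F, s.card % 2 = 1 ∧ s.card + 1 ≤ 2 * k := by
    intro s hs
    simp only [hF, Finset.mem_biUnion, Finset.mem_Icc, Finset.mem_powersetCard] at hs
    obtain ⟨i, hi, -, hc⟩ := hs
    omega
  -- Taking antipodes carries the half with first coordinate 0 to the half with first coordinate 1,
  -- hence the factor 2.
  have hinj : Function.Injective fun s : Finset (Fin n) => consIndicator true sᶜ :=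
    (consIndicator_injective true).comp compl_injective
  rw [← hFcard, two_mul]
  nth_rw 1 [← Finset.card_image_of_injective F (consIndicator_injective false)]
  rw [← Finset.card_image_of_injective F hinj, ← Finset.card_union_of_disjoint]
  · refine Finset.card_le_card (Finset.union_subset ?_ ?_)
    · intro v hv
      obtain ⟨s, hs, rfl⟩ := Finset.mem_image.1 hv
      have := hmemF s hs
      rw [mem_halfLayers, weight_consIndicator]
      simpa [consIndicator] using this
    · intro v hv
      obtain ⟨s, hs, rfl⟩ := Finset.mem_image.1 hv
      have := hmemF s hs
      have hle : s.card ≤ n := by simpa using s.card_le_univ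
      rw [mem_halfLayers, weight_consIndicator, Finset.card_compl, Fintype.card_fin]
      simp [consIndicator]
      omega
  · rw [Finset.disjoint_left]
    intro v hv hv'
    obtain ⟨s, -, rfl⟩ := Finset.mem_image.1 hv
    obtain ⟨t, -, ht⟩ := Finset.mem_image.1 hv'
    have := congrFun ht 0
    simp [consIndicator] at this

theorem two_mul_sum_choose_le_oddIndepNum {k : ℕ} (hk : 1 ≤ k) :
    2 * ∑ i ∈ Finset.Icc 1 k, (4 * k - 1).choose (2 * i - 1) ≤
      oddIndepNum (hypercube (4 * k)) := by
  obtain ⟨n, hn⟩ : ∃ n, n + 1 = 4 * k := ⟨4 * k - 1, by omega⟩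
  rw [← hn, Nat.add_sub_cancel]
  exact (two_mul_sum_choose_le_card_halfLayers hn).trans
    (le_oddIndepNum (isOddIndepSet_halfLayers hn))

end MiddleLayers

/-- From d|S| ≤ (d - 1)|T| and |T| ≤ d|U| one gets d(d + 1)|S| ≤ d(d - 1)(|T| + |U|); cancelling d >
0 gives the bound. -/
theorem card_le_of_isOddIndepSet_hypercube {d : ℕ} (hd : Even d) (hpos : 0 < d)
    {S : Finset (Fin d → Bool)} (h : IsOddIndepSet (hypercube d) S) : 2 * d * S.card + 2 ^ d ≤ d * 2 ^ d := by
  have h1 := card_partition h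
  have h2 := card_touched_le hd h
  have h3 := mul_card_add_card_touched_le hd h
  rw [← h1]
  nlinarith

theorem mainTheorem4 :
    (∀ k : ℕ, 1 ≤ k →
      2 * ∑ i ∈ Finset.Icc 1 k, (4 * k - 1).choose (2 * i - 1) ≤ oddIndepNum (hypercube (4 * k))) ∧
    (oddIndepNum (hypercube 4) = 6 ∧
      oddIndepNum (hypercube 6) = 24 ∧
      oddIndepNum (hypercube 8) = 112) ∧
    (∀ d : ℕ, Even d → 8 ≤ d →
      (7 / 16 : ℝ) * 2 ^ d ≤ (oddIndepNum (hypercube d) : ℝ)) := by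
  have h4 : 6 ≤ oddIndepNum (hypercube 4) := by
    simpa using two_mul_sum_choose_le_oddIndepNum le_rfl
  have h6 : 4 * oddIndepNum (hypercube 4) ≤ oddIndepNum (hypercube 6) :=
    four_mul_oddIndepNum_hypercube_le 3
  have h8 := seven_sixteenths_le_oddIndepNum (d := 8) (by decide) le_rfl
  refine ⟨fun k hk => two_mul_sum_choose_le_oddIndepNum hk, ⟨?_, ?_, ?_⟩, fun d hd hd8 => ?_⟩
  · obtain ⟨S, hS, hc⟩ := (oddIndepNum_isGreatest (hypercube 4)).1
    have := card_le_of_isOddIndepSet_hypercube (by decide) (by decide) hS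
    omega
  · obtain ⟨S, hS, hc⟩ := (oddIndepNum_isGreatest (hypercube 6)).1
    have := card_le_of_isOddIndepSet_hypercube_six hS
    omega
  · obtain ⟨S, hS, hc⟩ := (oddIndepNum_isGreatest (hypercube 8)).1
    have := card_le_of_isOddIndepSet_hypercube (by decide) (by decide) hS
    omega
  · have h : (7 * 2 ^ d : ℝ) ≤ 16 * oddIndepNum (hypercube d) := by
      exact_mod_cast seven_sixteenths_le_oddIndepNum hd hd8
    linarith
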